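/- For a finite simple graph $G=(V,E)$, the symmetric edge polytope $\mathcal P_G\subset\mathbb R^V$ is the convex hull of the points $\pm(\mathbf e_i-\mathbf e_j)$ with $\{i,j\}\in E$, where $\mathbf e_i$ denotes the $i$-th unit coordinate vector. For a polytope $\mathcal P$, let $N(\mathcal P)$ be its number of facets, that is, of faces of dimension $\dim\mathcal P-1$. The join $G_1+G_2$ of two graphs $G_1=(V,E)$ and $G_2=(V',E')$ with $V\cap V'=\emptyset$ is the graph on $V\cup V'$ with edge set $E\cup E'\cup\{\{i,j\}: i\in V,\ j\in V'\}$. **Theorem.** Let $G_1=(V,E)$ and $G_2=(V',E')$ be finite simple graphs (not necessarily connected) with nonempty vertex sets, $V\cap V'=\emptyset$, and let $n=|V|+|V'|$. Then \[ 3\cdot 2^{\frac{n-1}{2}}-2\ \le\ N(\mathcal P_{G_1+G_2})\ \le\ 6^{\frac{n-1}{2}}\quad\text{if } n \text{ is odd}, \] \[ 2^{\frac n2+1}-2\ \le\ N(\mathcal P_{G_1+G_2})\ \le\ 14\cdot 6^{\frac n2-2}\quad\text{if } n \text{ is even}. \] Consequently, the same bounds hold, with $N(\mathcal P_G)$ in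 place of $N(\mathcal P_{G_1+G_2})$, for every connected finite simple graph $G$ with $n$ vertices whose complement is not connected. -/

import Mathlib

universe u v

/-- The symmetric edge polytope of `G`: the convex hull in `ℝ^V` of the points
`±(e_i - e_j)`, where `{i, j}` runs over the edges of `G`. -/
def symmetricEdgePolytope {V : Type u} [DecidableEq V] (G : SimpleGraph V) : Set (V → ℝ) :=
  convexHull ℝ {x | ∃ i j, G.Adj i j ∧
    (x = Pi.single i 1 - Pi.single j 1 ∨ x = -(Pi.single i 1 - Pi.single j 1))}

/-- `F` is a facet of the polytope `P ⊆ ℝ^V`: a nonempty face of `P` (the set of maximizers over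
`P` of some linear functional) whose dimension is one less than the dimension of `P`. -/
def IsFacet {V : Type u} (P F : Set (V → ℝ)) : Prop :=
  F.Nonempty ∧ IsExposed ℝ P F ∧
    Module.finrank ℝ (vectorSpan ℝ F) + 1 = Module.finrank ℝ (vectorSpan ℝ P)

/-- The number of facets of a polytope. -/
noncomputable def numFacets {V : Type u} (P : Set (V → ℝ)) : ℕ :=
  {F : Set (V → ℝ) | IsFacet P F}.ncard

/-- The join of two graphs: their disjoint union, together with all edges between
the two vertex sets. -/
def graphJoin {V : Type u} {W : Type v} (G₁ : SimpleGraph V) (G₂ : SimpleGraph W) :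
    SimpleGraph (V ⊕ W) :=
  SimpleGraph.sum G₁ G₂ ⊔ completeBipartiteGraph V W

/-! A facet of the polytope of a connected graph is cut out by a function `f` on the vertices,
unique up to an additive constant, which changes by at most 1 along every edge and whose tight edges
(change exactly 1) form a connected spanning subgraph. Hence `f` may be taken integer-valued.

Let every vertex of `S` be joined to every vertex outside `S`, with both sides nonempty of sizes `p`
and `q`. If `f` is constant off `S`, normalise it to vanish there: its values on `S` lie in {-1, 0,
1}, and the facet conditions become exactly those of `dominatingSigns`. The case of `f` constant on
`S` is symmetric. If `f` is constant on neither side, the edges across force two consecutive values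
in all, so `f` is an indicator function up to a constant; there are at most `(2^p - 2)(2^q - 2)` of
these. Exactly two facets belong to both of the first two families. With `D` the number of
dominating sign functions on a side, this gives `D(S) + D(Sᶜ) - 2 ≤ N ≤ D(S) + D(Sᶜ) - 2 + (2^p -
2)(2^q - 2)`.

It remains to bound `D` on a set of `m` vertices. Assigning values one vertex at a time always
leaves two choices, so `2^m ≤ D`, and convexity of `2^x` gives the lower bounds. Branching on a
vertex of minimum degree gives `D ≤ maxDominatingSigns m` (`ncard_extensions_le`), and the
arithmetic inequality `maxDominatingSigns_add_le` bounds the total by `maxDominatingSigns (n - 1)`,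
which is the stated upper bound for `n ≥ 3`. -/

/-! ### Dominating sign functions: lower bound -/

/-- The sign functions supported on `S` that are never opposite across an edge of `G` and whose
zeros in `S` all have a neighbour where the function does not vanish. -/
def dominatingSigns {V : Type u} (G : SimpleGraph V) (S : Set V) : Set (V → SignType) :=
  {g | (∀ i ∉ S, g i = 0) ∧ (∀ i j, G.Adj i j → g i = 1 → g j ≠ -1) ∧
    ∀ i ∈ S, g i = 0 → ∃ j, G.Adj i j ∧ g j ≠ 0}

lemma SignType.eq_one_or_eq_neg_one {a : SignType} (h : a ≠ 0) : a = 1 ∨ a = -1 := by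
  revert h; revert a; decide

lemma eq_zero_or_eq_of_mem_dominatingSigns {V : Type u} {G : SimpleGraph V} {S : Set V}
    {g : V → SignType} (hg : g ∈ dominatingSigns G S) {i j : V} (hij : G.Adj i j)
    (hj : g j ≠ 0) : g i = 0 ∨ g i = g j := by
  have h1 := hg.2.1 i j hij
  have h2 := hg.2.1 j i hij.symm
  revert h1 h2 hj
  generalize g i = a
  generalize g j = b
  revert a b
  decide

/-- Completing a partial sign function: if the values assigned next to the unassigned set `Q` are
zero or a common sign `e`, there are at least `2 ^ #Q` dominating extensions. -/
lemma two_pow_card_le_ncard_extensions {V : Type u} [Fintype V] [DecidableEq V]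
    (G : SimpleGraph V) (S : Set V) (n : ℕ) :
    ∀ (Q : Finset V) (f : V → SignType) (e : SignType), Q.card = n → (∀ i ∈ Q, i ∈ S) →
      (∀ i ∉ S, f i = 0) →
      (∀ i ∉ Q, ∀ j ∉ Q, G.Adj i j → f i = 1 → f j ≠ -1) →
      (∀ i ∈ S, i ∉ Q → f i = 0 → ∃ j ∉ Q, G.Adj i j ∧ f j ≠ 0) →
      e ≠ 0 → (∀ i ∈ Q, ∀ j ∉ Q, G.Adj i j → f j = 0 ∨ f j = e) →
      2 ^ n ≤ {g ∈ dominatingSigns G S | ∀ i ∉ Q, g i = f i}.ncard := by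
  induction n with
  | zero =>
    intro Q f e hQ hQS hfS hfc hfd he hQe
    obtain rfl : Q = ∅ := Finset.card_eq_zero.1 hQ
    rw [pow_zero, Nat.one_le_iff_ne_zero, ← Nat.pos_iff_ne_zero, Set.ncard_pos (Set.toFinite _)]
    refine ⟨f, ⟨hfS, fun i j => hfc i (by simp) j (by simp), fun i hi h0 => ?_⟩, fun _ _ => rfl⟩
    obtain ⟨j, -, hj⟩ := hfd i hi (by simp) h0
    exact ⟨j, hj⟩
  | succ n ih =>
    intro Q f e hQ hQS hfS hfc hfd he hQe
    -- Two admissible values at one vertex give disjoint families of extensions, hence the factor 2.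
    have key : ∀ v ∈ Q, ∀ a b : SignType, a ≠ b →
        2 ^ n ≤ {g ∈ dominatingSigns G S | ∀ i ∉ Q.erase v, g i = Function.update f v a i}.ncard →
        2 ^ n ≤ {g ∈ dominatingSigns G S | ∀ i ∉ Q.erase v, g i = Function.update f v b i}.ncard →
        2 ^ (n + 1) ≤ {g ∈ dominatingSigns G S | ∀ i ∉ Q, g i = f i}.ncard := by
      intro v hv a b hab ha hb
      have hsub : ∀ c : SignType,
          {g ∈ dominatingSigns G S | ∀ i ∉ Q.erase v, g i = Function.update f v c i} ⊆
          {g ∈ dominatingSigns G S | ∀ i ∉ Q, g i = f i} := by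
        rintro c g ⟨hg, h⟩
        refine ⟨hg, fun i hi => ?_⟩
        have hiv : i ≠ v := by rintro rfl; exact hi hv
        rw [h i (by simp [hi]), Function.update_of_ne hiv]
      have hdisj : Disjoint
          {g ∈ dominatingSigns G S | ∀ i ∉ Q.erase v, g i = Function.update f v a i}
          {g ∈ dominatingSigns G S | ∀ i ∉ Q.erase v, g i = Function.update f v b i} := by
        rw [Set.disjoint_left]
        rintro g ⟨-, h⟩ ⟨-, h'⟩
        have := h v (by simp)
        have := h' v (by simp)
        simp_all
      have := Set.ncard_le_ncard (Set.union_subset (hsub a) (hsub b)) (Set.toFinite _)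
      rw [Set.ncard_union_eq hdisj (Set.toFinite _) (Set.toFinite _)] at this
      rw [pow_succ]; omega
    have step : ∀ v ∈ Q, ∀ a e' : SignType, e' ≠ 0 →
        (∀ j ∉ Q, G.Adj v j → (a = 1 → f j ≠ -1) ∧ (f j = 1 → a ≠ -1)) →
        (a = 0 → ∃ j ∉ Q, G.Adj v j ∧ f j ≠ 0) →
        (a = 0 ∨ a = e') → (∀ i ∈ Q, ∀ j ∉ Q, G.Adj i j → f j = 0 ∨ f j = e') →
        2 ^ n ≤
          {g ∈ dominatingSigns G S | ∀ i ∉ Q.erase v, g i = Function.update f v a i}.ncard := by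
      intro v hv a e' he' hc hd ha hQe'
      have hout : ∀ j, j ∉ Q.erase v → j ≠ v → j ∉ Q := by
        intro j hj hjv; simpa [hjv] using hj
      have hvn : ∀ j ∉ Q, j ≠ v := by rintro j hj rfl; exact hj hv
      apply ih (Q.erase v) _ e'
      · rw [Finset.card_erase_of_mem hv, hQ]; rfl
      · intro i hi; exact hQS i (Finset.mem_of_mem_erase hi)
      · intro i hi
        have hiv : i ≠ v := by rintro rfl; exact hi (hQS i hv)
        rw [Function.update_of_ne hiv]; exact hfS i hi
      · intro i hi j hj hij
        rcases eq_or_ne i v with rfl | hiv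
        · have hji : j ≠ i := hij.ne'
          rw [Function.update_self, Function.update_of_ne hji]
          exact (hc j (hout j hj hji) hij).1
        · rw [Function.update_of_ne hiv]
          rcases eq_or_ne j v with rfl | hjv
          · rw [Function.update_self]
            exact (hc i (hout i hi hiv) hij.symm).2
          · rw [Function.update_of_ne hjv]
            exact hfc i (hout i hi hiv) j (hout j hj hjv) hij
      · intro i hi hiQ h0
        have : ∃ j ∉ Q, G.Adj i j ∧ f j ≠ 0 := by
          rcases eq_or_ne i v with rfl | hiv
          · rw [Function.update_self] at h0; exact hd h0
          · rw [Function.update_of_ne hiv] at h0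
            exact hfd i hi (hout i hiQ hiv) h0
        obtain ⟨j, hj, hij, hfj⟩ := this
        exact ⟨j, by simp [hj], hij, by rwa [Function.update_of_ne (hvn j hj)]⟩
      · exact he'
      · intro i hi j hj hij
        rcases eq_or_ne j v with rfl | hjv
        · rwa [Function.update_self]
        · rw [Function.update_of_ne hjv]
          exact hQe' i (Finset.mem_of_mem_erase hi) j (hout j hj hjv) hij
    -- A vertex with a nonzero assigned neighbour may take 0, being already dominated, or the common
    -- sign `e`. If no vertex of `Q` has such a neighbour, any vertex may take either sign, and the
    -- sign chosen becomes the new common sign.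
    by_cases hex : ∃ v ∈ Q, ∃ j ∉ Q, G.Adj v j ∧ f j ≠ 0
    · obtain ⟨v, hv, j, hj, hvj, hfj⟩ := hex
      refine key v hv 0 e he.symm ?_ ?_
      · refine step v hv 0 e he (fun k _ _ => by generalize f k = x; revert x; decide) (fun _ => ⟨j, hj, hvj, hfj⟩)
          (Or.inl rfl) hQe
      · refine step v hv e e he (fun k hk hvk => ?_) (fun h => absurd h he) (Or.inr rfl) hQe
        have := hQe v hv k hk hvk
        revert this he
        generalize f k = x
        clear hQe
        revert x e
        decide
    · push Not at hex
      obtain ⟨v, hv⟩ : Q.Nonempty := by rw [← Finset.card_pos]; omega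
      refine key v hv 1 (-1) (by decide) ?_ ?_
      · refine step v hv 1 1 (by decide) (fun k hk hvk => ?_) (fun h => absurd h (by decide)) (Or.inr rfl)
          (fun i hi j hj hij => Or.inl (hex i hi j hj hij))
        rw [hex v hv k hk hvk]; decide
      · refine step v hv (-1) (-1) (by decide) (fun k hk hvk => ?_) (fun h => absurd h (by decide)) (Or.inr rfl)
          (fun i hi j hj hij => Or.inl (hex i hi j hj hij))
        rw [hex v hv k hk hvk]; decide

lemma two_pow_ncard_le_ncard_dominatingSigns {V : Type u} [Finite V]
    (G : SimpleGraph V) (S : Set V) : 2 ^ S.ncard ≤ (dominatingSigns G S).ncard := by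
  classical
  have := Fintype.ofFinite V
  have h := two_pow_card_le_ncard_extensions G S S.ncard S.toFinset 0 1
    (Set.ncard_eq_toFinset_card' S).symm (by simp) (by simp) (by intros; simp_all)
    (by intros; simp_all) (by decide) (by simp)
  exact h.trans (Set.ncard_le_ncard (fun g hg => hg.1) (Set.toFinite _))

/-! ### Arithmetic of the extremal numbers -/

/-- The largest number of dominating sign functions on `n` vertices, attained by disjoint unions of
complete graphs `K₂`, with one `K₃` (or `K₁` if `n = 1`) for `n` odd. -/
def maxDominatingSigns : ℕ → ℕ
  | 0 => 1
  | 1 => 2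
  | 2 => 6
  | 3 => 14
  | n + 4 => 6 * maxDominatingSigns (n + 2)

lemma maxDominatingSigns_add_two {n : ℕ} (hn : 2 ≤ n) :
    maxDominatingSigns (n + 2) = 6 * maxDominatingSigns n := by
  obtain ⟨m, rfl⟩ := Nat.exists_eq_add_of_le' hn
  rfl

lemma six_mul_maxDominatingSigns_le (n : ℕ) :
    6 * maxDominatingSigns n ≤ maxDominatingSigns (n + 2) := by
  match n with
  | 0 => decide
  | 1 => decide
  | n + 2 => exact (maxDominatingSigns_add_two (by omega)).ge

lemma two_mul_maxDominatingSigns_le (n : ℕ) :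
    2 * maxDominatingSigns n ≤ maxDominatingSigns (n + 1) := by
  induction n using Nat.strong_induction_on with
  | _ n ih =>
    match n with
    | 0 => decide
    | 1 => decide
    | 2 => decide
    | 3 => decide
    | n + 4 =>
      have := ih (n + 2) (by omega)
      rw [show n + 4 + 1 = n + 1 + 4 by omega, maxDominatingSigns, maxDominatingSigns,
        show n + 1 + 2 = n + 2 + 1 by omega]
      omega

lemma two_pow_mul_maxDominatingSigns_le (k n : ℕ) :
    2 ^ k * maxDominatingSigns n ≤ maxDominatingSigns (n + k) := by
  induction k with
  | zero => simp
  | succ k ih =>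
    calc 2 ^ (k + 1) * maxDominatingSigns n = 2 * (2 ^ k * maxDominatingSigns n) := by ring
      _ ≤ 2 * maxDominatingSigns (n + k) := by gcongr
      _ ≤ _ := two_mul_maxDominatingSigns_le _

lemma two_pow_le_maxDominatingSigns (n : ℕ) : 2 ^ n ≤ maxDominatingSigns n := by
  simpa [maxDominatingSigns] using two_pow_mul_maxDominatingSigns_le n 0

/-- The factor `2^(d+2) - 2 = 2 (2^(d+1) - 1)` counts the dominating sign functions of a complete
graph on `d + 1` vertices: a sign and a nonempty support. From `d = 3` on, trading two vertices for
a factor 6 loses nothing. -/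
lemma two_pow_sub_two_mul_maxDominatingSigns_le (d m : ℕ) :
    (2 ^ (d + 2) - 2) * maxDominatingSigns m ≤ maxDominatingSigns (m + (d + 1)) := by
  induction d using Nat.strong_induction_on generalizing m with
  | _ d ih =>
    match d with
    | 0 => simpa using two_mul_maxDominatingSigns_le m
    | 1 => simpa using six_mul_maxDominatingSigns_le m
    | 2 =>
      induction m using Nat.strong_induction_on with
      | _ m ihm =>
        match m with
        | 0 => decide
        | 1 => decide
        | 2 => decide
        | 3 => decide
        | m + 4 =>
          have := ihm (m + 2) (by omega)
          rw [show m + 4 + (2 + 1) = (m + 3) + 4 by omega, maxDominatingSigns, maxDominatingSigns]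
          rw [show m + 2 + (2 + 1) = m + 3 + 2 by omega] at this
          omega
    | d + 3 =>
      have h := ih (d + 1) (by omega) m
      have h6 := six_mul_maxDominatingSigns_le (m + (d + 1 + 1))
      rw [show m + (d + 3 + 1) = m + (d + 1 + 1) + 2 by omega]
      refine le_trans ?_ h6
      refine le_trans ?_ (Nat.mul_le_mul_left 6 h)
      rw [← mul_assoc]
      refine Nat.mul_le_mul_right _ ?_
      have : 1 ≤ 2 ^ d := Nat.one_le_two_pow
      rw [show d + 3 + 2 = d + 5 by omega, show d + 1 + 2 = d + 3 by omega, pow_add, pow_add]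
      omega

/-- Raising `q` by 2 multiplies `maxDominatingSigns q` and the right-hand main term by 6, but the
product of powers grows more slowly, up to an error absorbed by `2 ^ p ≤ maxDominatingSigns p`. This
reduces to `p, q ∈ {2, 3}`; equality holds if `p` or `q` is 1, and at `p = q = 2`. -/
lemma maxDominatingSigns_add_le {p q : ℕ} (hp : 1 ≤ p) (hq : 1 ≤ q) :
    maxDominatingSigns p + maxDominatingSigns q + (2 ^ p - 2) * (2 ^ q - 2) ≤
      maxDominatingSigns (p + q - 1) + 2 := by
  have step : ∀ p q : ℕ, 2 ≤ p → 2 ≤ q →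
      maxDominatingSigns p + maxDominatingSigns q + (2 ^ p - 2) * (2 ^ q - 2) ≤
        maxDominatingSigns (p + q - 1) + 2 →
      maxDominatingSigns p + maxDominatingSigns (q + 2) + (2 ^ p - 2) * (2 ^ (q + 2) - 2) ≤
        maxDominatingSigns (p + (q + 2) - 1) + 2 := by
    intro p q hp hq h
    rw [show p + (q + 2) - 1 = p + q - 1 + 2 by omega, maxDominatingSigns_add_two hq,
      maxDominatingSigns_add_two (by omega : 2 ≤ p + q - 1)]
    have hup := two_pow_le_maxDominatingSigns p
    have h4p : 4 ≤ 2 ^ p := (Nat.pow_le_pow_right (by norm_num) hp : 2 ^ 2 ≤ 2 ^ p)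
    have h4q : 4 ≤ 2 ^ q := (Nat.pow_le_pow_right (by norm_num) hq : 2 ^ 2 ≤ 2 ^ q)
    obtain ⟨a, ha⟩ := Nat.exists_eq_add_of_le' h4p
    obtain ⟨b, hb⟩ := Nat.exists_eq_add_of_le' h4q
    have e1 : 2 ^ p - 2 = a + 2 := by omega
    have e2 : 2 ^ q - 2 = b + 2 := by omega
    have e3 : 2 ^ (q + 2) - 2 = 4 * b + 14 := by rw [pow_add]; omega
    rw [e1, e2] at h
    rw [e1, e3]
    nlinarith [Nat.zero_le (a * b)]
  have main : ∀ n p q : ℕ, p + q = n → 2 ≤ p → 2 ≤ q →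
      maxDominatingSigns p + maxDominatingSigns q + (2 ^ p - 2) * (2 ^ q - 2) ≤
        maxDominatingSigns (p + q - 1) + 2 := by
    intro n
    induction n using Nat.strong_induction_on with
    | _ n ih =>
      intro p q hn hp hq
      by_cases hq4 : 4 ≤ q
      · obtain ⟨r, rfl⟩ := Nat.exists_eq_add_of_le' hq4
        exact step p (r + 2) hp (by omega) (ih _ (by omega) p (r + 2) rfl hp (by omega))
      by_cases hp4 : 4 ≤ p
      · obtain ⟨r, rfl⟩ := Nat.exists_eq_add_of_le' hp4
        have := step q (r + 2) hq (by omega) (ih _ (by omega) q (r + 2) rfl hq (by omega))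
        rw [add_comm (r + 4) q, mul_comm, add_comm (maxDominatingSigns (r + 4))]
        exact this
      interval_cases p <;> interval_cases q <;> decide
  rcases eq_or_lt_of_le hp with rfl | hp
  · simp [maxDominatingSigns]; omega
  rcases eq_or_lt_of_le hq with rfl | hq
  · simp [maxDominatingSigns]
  exact main _ p q rfl hp hq

lemma maxDominatingSigns_even (k : ℕ) : maxDominatingSigns (2 * k) = 6 ^ k := by
  induction k with
  | zero => rfl
  | succ k ih =>
    match k with
    | 0 => rfl
    | k + 1 =>
      rw [show 2 * (k + 1 + 1) = 2 * k + 4 by ring, maxDominatingSigns,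
        show 2 * k + 2 = 2 * (k + 1) by ring, ih]; ring

lemma maxDominatingSigns_odd (k : ℕ) : maxDominatingSigns (2 * k + 3) = 14 * 6 ^ k := by
  induction k with
  | zero => rfl
  | succ k ih =>
    rw [show 2 * (k + 1) + 3 = 2 * k + 3 + 2 by ring, maxDominatingSigns_add_two (by omega), ih]
    ring

lemma two_mul_two_pow_le (a k : ℕ) (b : ℕ) (h : a + b = 2 * k) : 2 * 2 ^ k ≤ 2 ^ a + 2 ^ b := by
  wlog hab : a ≤ b generalizing a b
  · rw [add_comm]; exact this b a (by omega) (by omega)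
  obtain ⟨t, rfl⟩ : ∃ t, k = a + t := ⟨k - a, by omega⟩
  obtain rfl : b = a + 2 * t := by omega
  have : 1 ≤ 2 ^ t := Nat.one_le_two_pow
  have h2 : 2 * 2 ^ t ≤ 1 + 2 ^ (2 * t) := by
    rw [pow_mul']; nlinarith [sq_nonneg ((2:ℤ) ^ t - 1), Nat.zero_le (2^t)]
  rw [pow_add, pow_add]
  nlinarith [Nat.zero_le (2 ^ a)]

lemma three_mul_two_pow_le (a k : ℕ) (b : ℕ) (h : a + b = 2 * k + 1) :
    3 * 2 ^ k ≤ 2 ^ a + 2 ^ b := by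
  wlog hab : a ≤ b generalizing a b
  · rw [add_comm]; exact this b a (by omega) (by omega)
  obtain ⟨t, rfl⟩ : ∃ t, k = a + t := ⟨k - a, by omega⟩
  obtain rfl : b = a + (2 * t + 1) := by omega
  obtain ⟨c, hc⟩ := Nat.exists_eq_add_of_le' (Nat.one_le_two_pow : 1 ≤ 2 ^ t)
  have h2 : 3 * 2 ^ t ≤ 1 + 2 ^ (2 * t + 1) := by
    rw [pow_succ, pow_mul', hc]; nlinarith
  rw [pow_add, pow_add]
  nlinarith [Nat.zero_le (2 ^ a)]

/-! ### Dominating sign functions: upper bound -/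

/-- Completing a partial sign function in which the vertices of `P` have, and those of `F` do not
have, a neighbour with an assigned nonzero value. -/
lemma ncard_extensions_le {V : Type u} [Finite V] (G : SimpleGraph V) (S : Set V) (n : ℕ) :
    ∀ (F P : Finset V) (f : V → SignType), F.card + P.card = n → (∀ i ∈ F, i ∉ P) →
      (∀ i ∈ F, i ∈ S) → (∀ i ∈ F, ∀ j ∉ F, j ∉ P → G.Adj i j → f j = 0) →
      (∀ i ∈ P, ∃ j ∉ F, j ∉ P ∧ G.Adj i j ∧ f j ≠ 0) →
      {g | g ∈ dominatingSigns G S ∧ ∀ i ∉ F, i ∉ P → g i = f i}.ncard ≤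
        maxDominatingSigns F.card * 2 ^ P.card := by
  classical
  induction n using Nat.strong_induction_on with
  | _ n ih =>
  intro F P f hn hFP hFS hF hP
  -- One branching step: `w` gets a nonzero value, the rest of `F \ F'` gets 0, and the neighbours
  -- of `w` in `F'` move to `P`, where only two values remain possible. Neighbours beyond the
  -- guaranteed `m` cost nothing, since a vertex of `F` contributes at least a factor 2.
  have assign : ∀ (F' P' : Finset V) (w : V) (a : SignType) (m : ℕ), F' ⊆ F → P' ⊆ P →
      (w ∈ F ∨ w ∈ P) → w ∉ F' → w ∉ P' → P ⊆ insert w P' → a ≠ 0 →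
      m ≤ (F'.filter (G.Adj w)).card →
      {g | (g ∈ dominatingSigns G S ∧ ∀ i ∉ F, i ∉ P → g i = f i) ∧ g w = a ∧
        ∀ i ∈ F, i ∉ F' → i ≠ w → g i = 0}.ncard ≤
        2 ^ m * maxDominatingSigns (F'.card - m) * 2 ^ P'.card := by
    intro F' P' w a m hF' hP' hw hwF hwP hPP ha hm
    set N := F'.filter (G.Adj w) with hN
    have hNF : N ⊆ F' := Finset.filter_subset _ _
    have hdisj : Disjoint P' N := by
      rw [Finset.disjoint_left]
      intro i hi hi'
      exact hFP i (hF' (hNF hi')) (hP' hi)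
    have hc1 : (F' \ N).card = F'.card - N.card := Finset.card_sdiff_of_subset hNF
    have hc2 : (P' ∪ N).card = P'.card + N.card := Finset.card_union_of_disjoint hdisj
    have hc3 := Finset.card_le_card hNF
    have hlt : F'.card + P'.card < n := by
      rw [← hn]
      have h1 := Finset.card_le_card hF'
      have h2 := Finset.card_le_card hP'
      rcases hw with hw | hw
      · have := Finset.card_lt_card (Finset.ssubset_iff_subset_ne.2
          ⟨hF', fun h => hwF (h ▸ hw)⟩)
        omega
      · have := Finset.card_lt_card (Finset.ssubset_iff_subset_ne.2
          ⟨hP', fun h => hwP (h ▸ hw)⟩)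
        omega
    have hmemP : ∀ j, j ≠ w → j ∉ P' → j ∉ P := by
      intro j hj hjP h
      rcases Finset.mem_insert.1 (hPP h) with h | h
      · exact hj h
      · exact hjP h
    have key := ih ((F' \ N).card + (P' ∪ N).card) (by omega) (F' \ N) (P' ∪ N)
      (fun i => if i = w then a else if i ∈ F then 0 else f i) rfl
      (by
        intro i hi
        rw [Finset.mem_sdiff] at hi
        rw [Finset.mem_union, not_or]
        exact ⟨fun h => hFP i (hF' hi.1) (hP' h), hi.2⟩)
      (by
        intro i hi
        exact hFS i (hF' (Finset.mem_sdiff.1 hi).1))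
      (by
        intro i hi j hj hj' hij
        rw [Finset.mem_sdiff] at hi
        rw [Finset.mem_union, not_or] at hj'
        have hjw : j ≠ w := by
          rintro rfl
          exact hi.2 (Finset.mem_filter.2 ⟨hi.1, hij.symm⟩)
        rw [if_neg hjw]
        split_ifs with hjF
        · rfl
        · exact hF i (hF' hi.1) j hjF (hmemP j hjw hj'.1) hij)
      (by
        intro i hi
        rcases Finset.mem_union.1 hi with hi | hi
        · obtain ⟨j, hjF, hjP, hij, hfj⟩ := hP i (hP' hi)
          have hjw : j ≠ w := by
            rintro rfl
            exact hw.elim hjF hjP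
          refine ⟨j, fun h => hjF (hF' (Finset.mem_sdiff.1 h).1), fun h => ?_, hij, ?_⟩
          · rcases Finset.mem_union.1 h with h | h
            · exact hjP (hP' h)
            · exact hjF (hF' (hNF h))
          · rwa [if_neg hjw, if_neg hjF]
        · refine ⟨w, fun h => hwF (Finset.mem_sdiff.1 h).1, fun h => ?_,
            (Finset.mem_filter.1 hi).2.symm, by rwa [if_pos rfl]⟩
          rcases Finset.mem_union.1 h with h | h
          · exact hwP h
          · exact hwF (hNF h))
    refine (Set.ncard_le_ncard ?_ (Set.toFinite _)).trans (key.trans ?_)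
    · rintro g ⟨⟨hg, hgf⟩, hgw, hg0⟩
      refine ⟨hg, fun i hi hi' => ?_⟩
      rw [Finset.mem_union, not_or] at hi'
      show g i = if i = w then a else if i ∈ F then 0 else f i
      split_ifs with h h'
      · rw [h, hgw]
      · refine hg0 i h' (fun h2 => hi (Finset.mem_sdiff.2 ⟨h2, hi'.2⟩)) h
      · exact hgf i h' (hmemP i h hi'.1)
    · rw [hc1, hc2]
      obtain ⟨t, ht⟩ := Nat.exists_eq_add_of_le hm
      have := two_pow_mul_maxDominatingSigns_le t (F'.card - N.card)
      rw [show F'.card - N.card + t = F'.card - m by omega] at this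
      calc maxDominatingSigns (F'.card - N.card) * 2 ^ (P'.card + N.card)
          = 2 ^ m * (2 ^ t * maxDominatingSigns (F'.card - N.card)) * 2 ^ P'.card := by
            rw [ht]; ring
        _ ≤ _ := by gcongr
  rcases P.eq_empty_or_nonempty with rfl | ⟨w, hw⟩
  · rcases F.eq_empty_or_nonempty with rfl | hne
    · simp only [Finset.card_empty, pow_zero, mul_one]
      rw [maxDominatingSigns, Set.ncard_le_one (Set.toFinite _)]
      rintro g ⟨-, hg⟩ g' ⟨-, hg'⟩
      funext i
      rw [hg i (by simp) (by simp), hg' i (by simp) (by simp)]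
    -- Let `d` be the minimum degree within `F`, attained at `v`. Each nonzero value of `v`
    -- contributes `2^d` and the value 0 contributes `2^(d+1) - 2`, all times `maxDominatingSigns
    -- (|F| - 1 - d)`; the total factor is `2^(d+2) - 2`.
    obtain ⟨v, hv, hmin⟩ := F.exists_min_image (fun x => (F.filter (G.Adj x)).card) hne
    set N := F.filter (G.Adj v) with hN
    have hNF : N ⊆ F.erase v := by
      intro i hi
      rw [hN, Finset.mem_filter] at hi
      exact Finset.mem_erase.2 ⟨hi.2.ne', hi.1⟩
    have hcv : (F.erase v).card = F.card - 1 := Finset.card_erase_of_mem hv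
    have hcN := Finset.card_le_card hNF
    have hFpos : 0 < F.card := Finset.card_pos.2 hne
    have hnz : ∀ a : SignType, a ≠ 0 →
        {g | (g ∈ dominatingSigns G S ∧ ∀ i ∉ F, i ∉ (∅ : Finset V) → g i = f i) ∧ g v = a ∧
          ∀ i ∈ F, i ∉ F.erase v → i ≠ v → g i = 0}.ncard ≤
        2 ^ N.card * maxDominatingSigns (F.card - 1 - N.card) := by
      intro a ha
      have := assign (F.erase v) ∅ v a N.card (Finset.erase_subset _ _) (by simp) (Or.inl hv)
        (by simp) (by simp) (by simp) ha (Finset.card_le_card (fun i hi =>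
          Finset.mem_filter.2 ⟨hNF hi, (Finset.mem_filter.1 hi).2⟩))
      rwa [hcv, Finset.card_empty, pow_zero, mul_one] at this
    -- If `v` has value 0, some neighbour in `N` must be nonzero. Enlarging `T`, the part of `N`
    -- allowed to be nonzero, by `x` adds at most `2 * 2^|T|` times the common factor, and the
    -- geometric sum is `2^(|T|+1) - 2`.
    have hz : ∀ T : Finset V, T ⊆ N →
        {g | (g ∈ dominatingSigns G S ∧ ∀ i ∉ F, i ∉ (∅ : Finset V) → g i = f i) ∧ g v = 0 ∧
          ∀ i ∈ N, i ∉ T → g i = 0}.ncard ≤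
        (2 ^ (T.card + 1) - 2) * maxDominatingSigns (F.card - 1 - N.card) := by
      intro T
      induction T using Finset.induction_on with
      | empty =>
        intro _
        rw [Set.ncard_eq_zero (Set.toFinite _) |>.2]
        · exact Nat.zero_le _
        rw [Set.eq_empty_iff_forall_notMem]
        rintro g ⟨⟨hg, hgf⟩, hgv, hg0⟩
        obtain ⟨j, hvj, hj⟩ := hg.2.2 v (hFS v hv) hgv
        by_cases hjF : j ∈ F
        · exact hj (hg0 j (Finset.mem_filter.2 ⟨hjF, hvj⟩) (by simp))
        · exact hj ((hgf j hjF (by simp)).trans (hF v hv j hjF (by simp) hvj))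
      | insert x T hxT ihT =>
        intro hT
        have hxN : x ∈ N := hT (Finset.mem_insert_self _ _)
        have hTN : T ⊆ N := fun i hi => hT (Finset.mem_insert_of_mem hi)
        have hx : ∀ a : SignType, a ≠ 0 →
            {g | (g ∈ dominatingSigns G S ∧ ∀ i ∉ F, i ∉ (∅ : Finset V) → g i = f i) ∧ g x = a ∧
              ∀ i ∈ F, i ∉ F.erase v \ (N \ T) → i ≠ x → g i = 0}.ncard ≤
            2 ^ T.card * maxDominatingSigns (F.card - 1 - N.card) := by
          intro a ha
          have hcT := Finset.card_le_card hTN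
          have hcT' := Finset.card_le_card hT
          have hci : (insert x T).card = T.card + 1 := Finset.card_insert_of_notMem hxT
          have h1 : (F.erase v \ (N \ T)).card = F.card - 1 - (N.card - T.card) := by
            rw [Finset.card_sdiff_of_subset (Finset.sdiff_subset.trans hNF), hcv,
              Finset.card_sdiff_of_subset hTN]
          -- By minimality `x` has at least `|N|` neighbours in `F`; at most `|N| - |T|` of them,
          -- namely `v` and `N \ insert x T`, have been set to 0.
          have h2 : T.card ≤ ((F.erase v \ (N \ T)).filter (G.Adj x)).card := by
            have hsub : F.filter (G.Adj x) ⊆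
                (F.erase v \ (N \ T)).filter (G.Adj x) ∪ insert v (N \ insert x T) := by
              intro i hi
              rw [Finset.mem_filter] at hi
              have := hi.2.ne'
              simp only [Finset.mem_union, Finset.mem_filter, Finset.mem_sdiff, Finset.mem_erase,
                Finset.mem_insert]
              tauto
            have h3 := (Finset.card_le_card hsub).trans (Finset.card_union_le _ _)
            have h4 := Finset.card_insert_le v (N \ insert x T)
            rw [Finset.card_sdiff_of_subset hT] at h4
            have h5 := hmin x (Finset.mem_filter.1 hxN).1
            omega
          have := assign (F.erase v \ (N \ T)) ∅ x a T.card
            (Finset.sdiff_subset.trans (Finset.erase_subset _ _)) (by simp)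
            (Or.inl (Finset.mem_filter.1 hxN).1) (by simp [hxN, hxT]) (by simp) (by simp) ha h2
          rwa [h1, Finset.card_empty, pow_zero, mul_one,
            show F.card - 1 - (N.card - T.card) - T.card = F.card - 1 - N.card by omega] at this
        have hzero : ∀ g : V → SignType, g v = 0 → (∀ i ∈ N, i ∉ insert x T → g i = 0) →
            ∀ i ∈ F, i ∉ F.erase v \ (N \ T) → i ≠ x → g i = 0 := by
          intro g hgv hg i hi hi' hix
          rcases eq_or_ne i v with rfl | hiv
          · exact hgv
          · simp only [Finset.mem_sdiff, Finset.mem_erase, not_and, not_not] at hi'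
            have h : i ∈ N ∧ i ∉ T := by tauto
            exact hg i h.1 (by simp [hix, h.2])
        have hsub : {g | (g ∈ dominatingSigns G S ∧ ∀ i ∉ F, i ∉ (∅ : Finset V) → g i = f i) ∧
              g v = 0 ∧ ∀ i ∈ N, i ∉ insert x T → g i = 0} ⊆
            {g | (g ∈ dominatingSigns G S ∧ ∀ i ∉ F, i ∉ (∅ : Finset V) → g i = f i) ∧
              g v = 0 ∧ ∀ i ∈ N, i ∉ T → g i = 0} ∪
            ({g | (g ∈ dominatingSigns G S ∧ ∀ i ∉ F, i ∉ (∅ : Finset V) → g i = f i) ∧ g x = 1 ∧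
              ∀ i ∈ F, i ∉ F.erase v \ (N \ T) → i ≠ x → g i = 0} ∪
            {g | (g ∈ dominatingSigns G S ∧ ∀ i ∉ F, i ∉ (∅ : Finset V) → g i = f i) ∧ g x = -1 ∧
              ∀ i ∈ F, i ∉ F.erase v \ (N \ T) → i ≠ x → g i = 0}) := by
          rintro g ⟨hg, hgv, hgN⟩
          by_cases hgx : g x = 0
          · left
            refine ⟨hg, hgv, fun i hi hiT => ?_⟩
            rcases eq_or_ne i x with rfl | hix
            · exact hgx
            · exact hgN i hi (by simp [hix, hiT])
          · right
            rcases SignType.eq_one_or_eq_neg_one hgx with h | h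
            · exact Or.inl ⟨hg, h, hzero g hgv hgN⟩
            · exact Or.inr ⟨hg, h, hzero g hgv hgN⟩
        refine (Set.ncard_le_ncard hsub (Set.toFinite _)).trans
          ((Set.ncard_union_le _ _).trans ?_)
        refine (add_le_add (ihT hTN) ((Set.ncard_union_le _ _).trans
          (add_le_add (hx 1 (by decide)) (hx (-1) (by decide))))).trans ?_
        rw [← add_mul, ← add_mul, Finset.card_insert_of_notMem hxT]
        refine Nat.mul_le_mul_right _ ?_
        have : 1 ≤ 2 ^ T.card := Nat.one_le_two_pow
        rw [pow_add, pow_succ, pow_succ]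
        omega
    have hsub : {g | g ∈ dominatingSigns G S ∧ ∀ i ∉ F, i ∉ (∅ : Finset V) → g i = f i} ⊆
        {g | (g ∈ dominatingSigns G S ∧ ∀ i ∉ F, i ∉ (∅ : Finset V) → g i = f i) ∧ g v = 0 ∧
          ∀ i ∈ N, i ∉ N → g i = 0} ∪
        ({g | (g ∈ dominatingSigns G S ∧ ∀ i ∉ F, i ∉ (∅ : Finset V) → g i = f i) ∧ g v = 1 ∧
          ∀ i ∈ F, i ∉ F.erase v → i ≠ v → g i = 0} ∪
        {g | (g ∈ dominatingSigns G S ∧ ∀ i ∉ F, i ∉ (∅ : Finset V) → g i = f i) ∧ g v = -1 ∧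
          ∀ i ∈ F, i ∉ F.erase v → i ≠ v → g i = 0}) := by
      intro g hg
      have hv0 : ∀ i ∈ F, i ∉ F.erase v → i ≠ v → g i = 0 := by
        intro i hi hi' hiv
        exact absurd (Finset.mem_erase.2 ⟨hiv, hi⟩) hi'
      by_cases hgv : g v = 0
      · exact Or.inl ⟨hg, hgv, fun i hi hi' => absurd hi hi'⟩
      · right
        rcases SignType.eq_one_or_eq_neg_one hgv with h | h
        · exact Or.inl ⟨hg, h, hv0⟩
        · exact Or.inr ⟨hg, h, hv0⟩
    refine (Set.ncard_le_ncard hsub (Set.toFinite _)).trans ((Set.ncard_union_le _ _).trans ?_)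
    refine (add_le_add (hz N subset_rfl) ((Set.ncard_union_le _ _).trans
      (add_le_add (hnz 1 (by decide)) (hnz (-1) (by decide))))).trans ?_
    have := two_pow_sub_two_mul_maxDominatingSigns_le N.card (F.card - 1 - N.card)
    rw [show F.card - 1 - N.card + (N.card + 1) = F.card by omega] at this
    rw [Finset.card_empty, pow_zero, mul_one, ← add_mul, ← add_mul]
    refine le_trans (Nat.mul_le_mul_right _ ?_) this
    have : 1 ≤ 2 ^ N.card := Nat.one_le_two_pow
    rw [pow_add, pow_add]
    omega
  · obtain ⟨j, hjF, hjP, hwj, hfj⟩ := hP w hw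
    have hwF : w ∉ F := fun h => hFP w h hw
    have hc : P.card = (P.erase w).card + 1 := (Finset.card_erase_add_one hw).symm
    have h1 := assign F (P.erase w) w (f j) 0 subset_rfl (Finset.erase_subset _ _) (Or.inr hw) hwF
      (by simp) (by rw [Finset.insert_erase hw]) hfj (Nat.zero_le _)
    have h0 := ih (F.card + (P.erase w).card) (by omega) F (P.erase w) (Function.update f w 0) rfl
      (fun i hi h => hFP i hi (Finset.mem_of_mem_erase h)) hFS
      (by
        intro i hi k hk hk' hik
        rcases eq_or_ne k w with rfl | hkw
        · rw [Function.update_self]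
        · rw [Function.update_of_ne hkw]
          exact hF i hi k hk (by simpa [hkw] using hk') hik)
      (by
        intro i hi
        obtain ⟨k, hkF, hkP, hik, hfk⟩ := hP i (Finset.mem_of_mem_erase hi)
        have hkw : k ≠ w := by rintro rfl; exact hkP hw
        exact ⟨k, hkF, fun h => hkP (Finset.mem_of_mem_erase h), hik,
          by rwa [Function.update_of_ne hkw]⟩)
    refine (Set.ncard_le_ncard ?_ (Set.toFinite _)).trans
      ((Set.ncard_union_le _ _).trans ((add_le_add h0 h1).trans ?_))
    · rintro g ⟨hg, hgf⟩
      have hgj : g j = f j := hgf j hjF hjP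
      rcases eq_zero_or_eq_of_mem_dominatingSigns hg hwj (by rwa [hgj]) with h | h
      · left
        refine ⟨hg, fun i hi hi' => ?_⟩
        rcases eq_or_ne i w with rfl | hiw
        · rw [Function.update_self, h]
        · rw [Function.update_of_ne hiw]
          exact hgf i hi (by simpa [hiw] using hi')
      · exact Or.inr ⟨⟨hg, hgf⟩, h.trans hgj, fun i hi hi' => absurd hi hi'⟩
    · rw [hc, pow_succ]
      apply le_of_eq
      simp only [pow_zero, Nat.sub_zero]
      ring

lemma ncard_dominatingSigns_le {V : Type u} [Finite V] (G : SimpleGraph V) (S : Set V) :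
    (dominatingSigns G S).ncard ≤ maxDominatingSigns S.ncard := by
  classical
  have := Fintype.ofFinite V
  have h := ncard_extensions_le G S S.ncard S.toFinset ∅ 0
    (by rw [Set.ncard_eq_toFinset_card' S]; rfl) (by simp) (by simp) (by simp) (by simp)
  rw [Finset.card_empty, pow_zero, mul_one, ← Set.ncard_eq_toFinset_card' S] at h
  refine (Set.ncard_le_ncard (fun g hg => ?_) (Set.toFinite _)).trans h
  exact ⟨hg, fun i hi _ => hg.1 i (by simpa using hi)⟩

/-! ### Facets of the symmetric edge polytope of a connected graph -/

/-- The subgraph of the edges across which the values of `f` differ by exactly `1`. -/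
def tightGraph {V : Type u} (G : SimpleGraph V) (f : V → ℝ) : SimpleGraph V where
  Adj i j := G.Adj i j ∧ |f i - f j| = 1
  symm := ⟨fun i j h => ⟨h.1.symm, by rw [abs_sub_comm]; exact h.2⟩⟩
  loopless := ⟨fun i h => G.loopless.irrefl i h.1⟩

/-- The functions defining the facets of the symmetric edge polytope of a connected graph. -/
structure IsFacetFunction {V : Type u} (G : SimpleGraph V) (f : V → ℝ) : Prop where
  sub_le : ∀ i j, G.Adj i j → f i - f j ≤ 1
  connected : (tightGraph G f).Connected

/-- The face of the symmetric edge polytope cut out by the hyperplane `f ⬝ᵥ x = 1`. -/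
def sepFace {V : Type u} [Fintype V] [DecidableEq V] (G : SimpleGraph V) (f : V → ℝ) :
    Set (V → ℝ) :=
  {x ∈ symmetricEdgePolytope G | f ⬝ᵥ x = 1}

/-- The edge vectors `e_i - e_j`, in both orientations. -/
def edgeVectors {V : Type u} [DecidableEq V] (G : SimpleGraph V) : Set (V → ℝ) :=
  {x | ∃ i j, G.Adj i j ∧ x = Pi.single i 1 - Pi.single j 1}

lemma IsFacetFunction.exists_tight {V : Type u} [Nontrivial V] {G : SimpleGraph V} {f : V → ℝ} (hf : IsFacetFunction G f) (i : V) :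
    ∃ j, G.Adj i j ∧ |f i - f j| = 1 := by
  obtain ⟨j, hj⟩ := hf.connected.preconnected.exists_adj_of_nontrivial i
  exact ⟨j, hj⟩

/-- The linear functional `x ↦ f ⬝ᵥ x`. -/
def dotLinear {V : Type u} [Fintype V] (f : V → ℝ) : (V → ℝ) →ₗ[ℝ] ℝ where
  toFun x := f ⬝ᵥ x
  map_add' := dotProduct_add f
  map_smul' c x := dotProduct_smul c f x

lemma dotLinear_apply {V : Type u} [Fintype V] (f x : V → ℝ) : dotLinear f x = f ⬝ᵥ x := rfl

section Facets

variable {V : Type u} [DecidableEq V] {G : SimpleGraph V}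

lemma symmetricEdgePolytope_eq : symmetricEdgePolytope G = convexHull ℝ (edgeVectors G) := by
  refine congrArg _ (Set.ext fun x => ⟨?_, ?_⟩)
  · rintro ⟨i, j, hij, rfl | rfl⟩
    · exact ⟨i, j, hij, rfl⟩
    · exact ⟨j, i, hij.symm, neg_sub _ _⟩
  · rintro ⟨i, j, hij, rfl⟩
    exact ⟨i, j, hij, Or.inl rfl⟩

lemma edgeVectors_subset : edgeVectors G ⊆ symmetricEdgePolytope G := by
  rw [symmetricEdgePolytope_eq]; exact subset_convexHull ℝ _

lemma symmetricEdgePolytope_subset_span :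
    symmetricEdgePolytope G ⊆ Submodule.span ℝ (edgeVectors G) := by
  rw [symmetricEdgePolytope_eq]
  exact convexHull_min Submodule.subset_span (Submodule.convex _)

lemma zero_mem_symmetricEdgePolytope {i j : V} (hij : G.Adj i j) :
    (0 : V → ℝ) ∈ symmetricEdgePolytope G := by
  have h1 := edgeVectors_subset (G := G) ⟨i, j, hij, rfl⟩
  have h2 := edgeVectors_subset (G := G) ⟨j, i, hij.symm, rfl⟩
  have hc : Convex ℝ (symmetricEdgePolytope G) := convex_convexHull _ _
  have := hc h1 h2 (a := 1 / 2) (b := 1 / 2) (by norm_num) (by norm_num) (by norm_num)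
  convert this using 1
  rw [← smul_add]; simp

lemma vectorSpan_symmetricEdgePolytope {i j : V} (hij : G.Adj i j) :
    vectorSpan ℝ (symmetricEdgePolytope G) = Submodule.span ℝ (edgeVectors G) := by
  rw [vectorSpan_eq_span_vsub_set_right ℝ (zero_mem_symmetricEdgePolytope hij)]
  simp only [vsub_eq_sub, sub_zero, Set.image_id']
  exact le_antisymm (Submodule.span_le.2 symmetricEdgePolytope_subset_span)
    (Submodule.span_mono edgeVectors_subset)

/-- The dimension of an affine slice off the origin is one less than that of its linear span. -/
lemma finrank_vectorSpan_add_one {E : Type u} [AddCommGroup E] [Module ℝ E]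
    [FiniteDimensional ℝ E] {F : Set E} (hF : F.Nonempty) (l : E →ₗ[ℝ] ℝ)
    (hl : ∀ x ∈ F, l x = 1) :
    Module.finrank ℝ (vectorSpan ℝ F) + 1 = Module.finrank ℝ (Submodule.span ℝ F) := by
  obtain ⟨x, hx⟩ := hF
  have hker : vectorSpan ℝ F ≤ LinearMap.ker l := by
    rw [vectorSpan_eq_span_vsub_set_right ℝ hx, Submodule.span_le]
    rintro _ ⟨y, hy, rfl⟩
    simp [hl x hx, hl y hy]
  have hx0 : x ≠ 0 := by
    rintro rfl
    simpa using hl 0 hx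
  have hsup : vectorSpan ℝ F ⊔ Submodule.span ℝ {x} = Submodule.span ℝ F := by
    apply le_antisymm
    · refine sup_le ?_ (Submodule.span_mono (Set.singleton_subset_iff.2 hx))
      rw [vectorSpan_eq_span_vsub_set_right ℝ hx, Submodule.span_le]
      rintro _ ⟨y, hy, rfl⟩
      exact Submodule.sub_mem _ (Submodule.subset_span hy) (Submodule.subset_span hx)
    · rw [Submodule.span_le]
      intro y hy
      have h1 : y - x ∈ vectorSpan ℝ F := vsub_mem_vectorSpan ℝ hy hx
      have := Submodule.add_mem_sup h1 (Submodule.mem_span_singleton_self (R := ℝ) x)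
      simpa using this
  have hinf : vectorSpan ℝ F ⊓ Submodule.span ℝ {x} = ⊥ := by
    rw [eq_bot_iff]
    rintro y ⟨hy, hy'⟩
    obtain ⟨c, rfl⟩ := Submodule.mem_span_singleton.1 hy'
    have := hker hy
    rw [LinearMap.mem_ker, map_smul, hl x hx, smul_eq_mul, mul_one] at this
    simp [this]
  have := Submodule.finrank_sup_add_finrank_inf_eq (vectorSpan ℝ F) (Submodule.span ℝ {x})
  rw [hsup, hinf, finrank_bot, finrank_span_singleton hx0] at this
  omega

lemma single_sub_single_mem_span_edgeVectors {H : SimpleGraph V} (hH : H.Preconnected) (i j : V) :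
    (Pi.single i 1 - Pi.single j 1 : V → ℝ) ∈ Submodule.span ℝ (edgeVectors H) := by
  obtain ⟨p⟩ := hH i j
  induction p with
  | nil => simp
  | @cons a b c h p ih =>
    have := Submodule.add_mem _ (Submodule.subset_span (R := ℝ)
      (show _ ∈ edgeVectors H from ⟨a, b, h, rfl⟩)) ih
    simpa using this

variable [Fintype V]

lemma dotProduct_single_sub_single (f : V → ℝ) (i j : V) :
    f ⬝ᵥ (Pi.single i 1 - Pi.single j 1) = f i - f j := by
  simp [dotProduct_sub]

lemma dotProduct_le_one {f : V → ℝ} (hf : ∀ i j, G.Adj i j → f i - f j ≤ 1) {x : V → ℝ}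
    (hx : x ∈ symmetricEdgePolytope G) : f ⬝ᵥ x ≤ 1 := by
  rw [symmetricEdgePolytope_eq] at hx
  refine convexHull_min ?_ (convex_halfSpace_le (dotLinear f).isLinear 1) hx
  rintro _ ⟨i, j, hij, rfl⟩
  show f ⬝ᵥ _ ≤ 1
  rw [dotProduct_single_sub_single]
  exact hf i j hij

/-- The face is spanned by the edge vectors that it contains. -/
lemma sepFace_subset_span {f : V → ℝ} (hf : ∀ i j, G.Adj i j → f i - f j ≤ 1) :
    sepFace G f ⊆ Submodule.span ℝ (edgeVectors (tightGraph G f)) := by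
  rintro x ⟨hx, hfx⟩
  rw [symmetricEdgePolytope_eq] at hx
  -- This set is convex: a combination with positive weights reaches 1 only if both points do.
  suffices h : x ∈ {y : V → ℝ | f ⬝ᵥ y ≤ 1 ∧
      (f ⬝ᵥ y = 1 → y ∈ Submodule.span ℝ (edgeVectors (tightGraph G f)))} from h.2 hfx
  refine convexHull_min ?_ ?_ hx
  · rintro _ ⟨i, j, hij, rfl⟩
    rw [Set.mem_ofPred_eq, dotProduct_single_sub_single]
    refine ⟨hf i j hij, fun h => Submodule.subset_span ⟨i, j, ⟨hij, by rw [h, abs_one]⟩, rfl⟩⟩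
  · rintro y ⟨hy1, hy2⟩ z ⟨hz1, hz2⟩ a b ha hb hab
    rw [Set.mem_ofPred_eq, dotProduct_add, dotProduct_smul, dotProduct_smul, smul_eq_mul,
      smul_eq_mul]
    refine ⟨by nlinarith, fun h => ?_⟩
    rcases ha.eq_or_lt with rfl | ha
    · obtain rfl : b = 1 := by linarith
      simpa using hz2 (by linarith)
    rcases hb.eq_or_lt with rfl | hb
    · obtain rfl : a = 1 := by linarith
      simpa using hy2 (by linarith)
    refine Submodule.add_mem _ (Submodule.smul_mem _ _ (hy2 ?_)) (Submodule.smul_mem _ _ (hz2 ?_))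
    · by_contra hne
      nlinarith [mul_pos ha (sub_pos.2 (lt_of_le_of_ne hy1 hne)),
        mul_nonneg hb.le (sub_nonneg.2 hz1)]
    · by_contra hne
      nlinarith [mul_pos hb (sub_pos.2 (lt_of_le_of_ne hz1 hne)),
        mul_nonneg ha.le (sub_nonneg.2 hy1)]

/-- A subgraph whose edge vectors span those of a connected graph is connected. -/
lemma connected_of_edgeVectors_subset_span {H : SimpleGraph V} (hG : G.Connected)
    (h : edgeVectors G ⊆ Submodule.span ℝ (edgeVectors H)) : H.Connected := by
  classical
  have := hG.nonempty
  rw [SimpleGraph.connected_iff_exists_forall_reachable]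
  obtain ⟨v⟩ := hG.nonempty
  -- The indicator of a component of `H` kills the edge vectors of `H`, hence those of `G`, so it is
  -- constant.
  let c : V → ℝ := fun i => if H.Reachable v i then 1 else 0
  have hker : Submodule.span ℝ (edgeVectors H) ≤ LinearMap.ker (dotLinear c) := by
    rw [Submodule.span_le]
    rintro _ ⟨i, j, hij, rfl⟩
    rw [SetLike.mem_coe, LinearMap.mem_ker, dotLinear_apply, dotProduct_single_sub_single,
      sub_eq_zero]
    have : H.Reachable v i ↔ H.Reachable v j :=
      ⟨fun h => h.trans hij.reachable, fun h => h.trans hij.symm.reachable⟩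
    simp only [c, this]
  have hadj : ∀ i j, G.Adj i j → c i = c j := by
    intro i j hij
    have := hker (h ⟨i, j, hij, rfl⟩)
    rwa [LinearMap.mem_ker, dotLinear_apply, dotProduct_single_sub_single, sub_eq_zero] at this
  refine ⟨v, fun w => ?_⟩
  obtain ⟨p⟩ := hG.preconnected v w
  have hw : c w = c v := by
    clear_value c
    clear hker
    induction p with
    | nil => rfl
    | @cons a b d hab p ih => rw [ih, hadj a b hab]
  by_contra hvw
  simp [c, hvw] at hw

lemma dotProduct_congr_of_sub_const {f g : V → ℝ} (hfg : ∀ i j, f i - f j = g i - g j) {x : V → ℝ}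
    (hx : x ∈ symmetricEdgePolytope G) : f ⬝ᵥ x = g ⬝ᵥ x := by
  have : Submodule.span ℝ (edgeVectors G) ≤ LinearMap.ker (dotLinear f - dotLinear g) := by
    rw [Submodule.span_le]
    rintro _ ⟨i, j, -, rfl⟩
    rw [SetLike.mem_coe, LinearMap.mem_ker, LinearMap.sub_apply, dotLinear_apply, dotLinear_apply,
      dotProduct_single_sub_single, dotProduct_single_sub_single, hfg, sub_self]
  have := this (symmetricEdgePolytope_subset_span hx)
  rwa [LinearMap.mem_ker, LinearMap.sub_apply, sub_eq_zero] at this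

lemma sepFace_congr {f g : V → ℝ} (hfg : ∀ i j, f i - f j = g i - g j) :
    sepFace G f = sepFace G g := by
  ext x
  constructor
  · rintro ⟨hx, h⟩
    exact ⟨hx, (dotProduct_congr_of_sub_const hfg hx).symm.trans h⟩
  · rintro ⟨hx, h⟩
    exact ⟨hx, (dotProduct_congr_of_sub_const hfg hx).trans h⟩

lemma edgeVectors_tightGraph_subset_span (f : V → ℝ) :
    edgeVectors (tightGraph G f) ⊆ Submodule.span ℝ (sepFace G f) := by
  rintro _ ⟨i, j, hij, rfl⟩
  rcases (abs_eq zero_le_one).1 hij.2 with h | h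
  · refine Submodule.subset_span ⟨edgeVectors_subset ⟨i, j, hij.1, rfl⟩, ?_⟩
    rw [dotProduct_single_sub_single, h]
  · rw [← neg_sub]
    refine Submodule.neg_mem _ (Submodule.subset_span
      ⟨edgeVectors_subset ⟨j, i, hij.1.symm, rfl⟩, ?_⟩)
    rw [dotProduct_single_sub_single]; linarith

lemma IsFacetFunction.single_sub_single_mem_span {f : V → ℝ} (hf : IsFacetFunction G f) (i j : V) :
    (Pi.single i 1 - Pi.single j 1 : V → ℝ) ∈ Submodule.span ℝ (sepFace G f) :=
  Submodule.span_le.2 (edgeVectors_tightGraph_subset_span f)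
    (single_sub_single_mem_span_edgeVectors hf.connected.preconnected i j)

/-- Both functionals equal 1 on the face, whose span contains every `e_i - e_j`. Facets thus
determine their functions up to a constant. -/
lemma IsFacetFunction.sub_eq_of_sepFace_eq {f g : V → ℝ} (hf : IsFacetFunction G f)
    (h : sepFace G f = sepFace G g) (i j : V) : f i - f j = g i - g j := by
  have hle : Submodule.span ℝ (sepFace G f) ≤ LinearMap.ker (dotLinear f - dotLinear g) := by
    rw [Submodule.span_le]
    intro x hx
    have hx' := hx
    rw [h] at hx'
    rw [SetLike.mem_coe, LinearMap.mem_ker, LinearMap.sub_apply, dotLinear_apply, dotLinear_apply,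
      hx.2, hx'.2, sub_self]
  have := hle (hf.single_sub_single_mem_span i j)
  rwa [LinearMap.mem_ker, LinearMap.sub_apply, dotLinear_apply, dotLinear_apply,
    dotProduct_single_sub_single, dotProduct_single_sub_single, sub_eq_zero] at this

lemma IsFacetFunction.isFacet [Nontrivial V] {f : V → ℝ} (hf : IsFacetFunction G f) :
    IsFacet (symmetricEdgePolytope G) (sepFace G f) := by
  obtain ⟨i⟩ : Nonempty V := inferInstance
  obtain ⟨j, hij, hfij⟩ := hf.exists_tight i
  have hne : (sepFace G f).Nonempty := by
    rcases (abs_eq zero_le_one).1 hfij with h | h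
    · exact ⟨_, edgeVectors_subset ⟨i, j, hij, rfl⟩, by rw [dotProduct_single_sub_single, h]⟩
    · exact ⟨_, edgeVectors_subset ⟨j, i, hij.symm, rfl⟩,
        by rw [dotProduct_single_sub_single]; linarith⟩
  refine ⟨hne, fun _ => ⟨LinearMap.toContinuousLinearMap (dotLinear f), ?_⟩, ?_⟩
  · ext x
    simp only [sepFace, Set.mem_ofPred_eq, LinearMap.coe_toContinuousLinearMap', dotLinear_apply]
    refine and_congr_right fun hx => ⟨fun h y hy => ?_, fun h => ?_⟩
    · rw [h]; exact dotProduct_le_one hf.sub_le hy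
    · obtain ⟨y, hy, hy1⟩ := hne
      exact le_antisymm (dotProduct_le_one hf.sub_le hx) (hy1 ▸ h y hy)
  · rw [finrank_vectorSpan_add_one hne (dotLinear f) (fun x hx => hx.2),
      vectorSpan_symmetricEdgePolytope hij]
    suffices h : Submodule.span ℝ (sepFace G f) = Submodule.span ℝ (edgeVectors G) by rw [h]
    apply le_antisymm
    · rw [Submodule.span_le]
      exact fun x hx => symmetricEdgePolytope_subset_span hx.1
    · rw [Submodule.span_le]
      rintro _ ⟨a, b, -, rfl⟩
      exact hf.single_sub_single_mem_span a b

lemma exists_isFacetFunction_of_isFacet [Nontrivial V] (hG : G.Connected) {F : Set (V → ℝ)}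
    (hF : IsFacet (symmetricEdgePolytope G) F) : ∃ f, IsFacetFunction G f ∧ F = sepFace G f := by
  obtain ⟨hne, hexp, hdim⟩ := hF
  obtain ⟨l, hl⟩ := hexp hne
  obtain ⟨x, hx⟩ := hne
  obtain ⟨i⟩ := hG.nonempty
  obtain ⟨j, hij⟩ := hG.preconnected.exists_adj_of_nontrivial i
  have hx' := hx
  rw [hl] at hx'
  have hM0 : 0 ≤ l x := by simpa using hx'.2 0 (zero_mem_symmetricEdgePolytope hij)
  -- The polytope is symmetric about 0, so a functional with maximum 0 vanishes on it; the face
  -- would be the whole polytope, of the wrong dimension.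
  have hM : l x ≠ 0 := by
    intro h0
    have hgen : ∀ y ∈ edgeVectors G, l y = 0 := by
      rintro _ ⟨a, b, hab, rfl⟩
      have h1 := hx'.2 _ (edgeVectors_subset ⟨a, b, hab, rfl⟩)
      have h2 := hx'.2 _ (edgeVectors_subset ⟨b, a, hab.symm, rfl⟩)
      rw [map_sub] at h1 h2 ⊢
      linarith
    have hspan : Submodule.span ℝ (edgeVectors G) ≤ LinearMap.ker (l : (V → ℝ) →ₗ[ℝ] ℝ) :=
      Submodule.span_le.2 hgen
    have hzero : ∀ y ∈ symmetricEdgePolytope G, l y = 0 := fun y hy =>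
      hspan (symmetricEdgePolytope_subset_span hy)
    have : F = symmetricEdgePolytope G := by
      rw [hl]
      ext y
      refine ⟨fun h => h.1, fun h => ⟨h, fun z hz => ?_⟩⟩
      rw [hzero y h, hzero z hz]
    rw [this] at hdim
    omega
  have hMpos := lt_of_le_of_ne hM0 hM.symm
  let f : V → ℝ := fun i => l (Pi.single i 1) / l x
  have hf : ∀ y, f ⬝ᵥ y = l y / l x := by
    intro y
    have h := LinearMap.pi_apply_eq_sum_univ (l : (V → ℝ) →ₗ[ℝ] ℝ) y
    rw [ContinuousLinearMap.coe_coe] at h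
    rw [h, Finset.sum_div, dotProduct]
    refine Finset.sum_congr rfl fun k _ => ?_
    have : (fun m => if k = m then (1 : ℝ) else 0) = Pi.single k 1 := by
      ext m
      simp [Pi.single_apply, eq_comm]
    rw [this, smul_eq_mul]
    simp only [f]
    ring
  have hle : ∀ a b, G.Adj a b → f a - f b ≤ 1 := by
    intro a b hab
    rw [← dotProduct_single_sub_single, hf, div_le_one hMpos]
    exact hx'.2 _ (edgeVectors_subset ⟨a, b, hab, rfl⟩)
  have hface : F = sepFace G f := by
    rw [hl]
    ext y
    simp only [sepFace, Set.mem_ofPred_eq, hf, div_eq_one_iff_eq hM]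
    refine and_congr_right fun hy => ⟨fun h => ?_, fun h z hz => ?_⟩
    · exact le_antisymm (hx'.2 y hy) (h x hx'.1)
    · rw [h]; exact hx'.2 z hz
  refine ⟨f, ⟨hle, connected_of_edgeVectors_subset_span hG ?_⟩, hface⟩
  rw [finrank_vectorSpan_add_one ⟨x, hx⟩ (dotLinear f) (fun y hy => (hface ▸ hy).2),
    vectorSpan_symmetricEdgePolytope hij] at hdim
  have hsub : Submodule.span ℝ F ≤ Submodule.span ℝ (edgeVectors G) := by
    rw [Submodule.span_le, hface]
    exact fun y hy => symmetricEdgePolytope_subset_span hy.1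
  have heq := Submodule.eq_of_le_of_finrank_eq hsub hdim
  intro y hy
  have hyF : y ∈ Submodule.span ℝ F := heq ▸ Submodule.subset_span hy
  rw [hface] at hyF
  exact Submodule.span_le.2 (sepFace_subset_span hle) hyF

lemma numFacets_symmetricEdgePolytope [Nontrivial V] (hG : G.Connected) :
    numFacets (symmetricEdgePolytope G) = (sepFace G '' {f | IsFacetFunction G f}).ncard := by
  unfold numFacets
  congr 1
  ext F
  constructor
  · intro hF
    obtain ⟨f, hf, rfl⟩ := exists_isFacetFunction_of_isFacet hG hF
    exact ⟨f, hf, rfl⟩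
  · rintro ⟨f, hf, rfl⟩
    exact hf.isFacet

end Facets

/-! ### Facet functions of a join -/

lemma IsFacetFunction.congr {V : Type u} {G : SimpleGraph V} {f g : V → ℝ}
    (hf : IsFacetFunction G f) (h : ∀ i j, f i - f j = g i - g j) : IsFacetFunction G g := by
  refine ⟨fun i j hij => h i j ▸ hf.sub_le i j hij, ?_⟩
  have : tightGraph G g = tightGraph G f := by
    ext i j
    simp only [tightGraph, h]
  rw [this]
  exact hf.connected

lemma IsFacetFunction.exists_int {V : Type u} {G : SimpleGraph V} {f : V → ℝ}
    (hf : IsFacetFunction G f) : ∃ k : V → ℤ, ∀ i j, f i - f j = (k i : ℝ) - k j := by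
  obtain ⟨v⟩ := hf.connected.nonempty
  have h : ∀ w, ∃ m : ℤ, f w - f v = m := by
    intro w
    obtain ⟨p⟩ := hf.connected.preconnected w v
    induction p with
    | nil => exact ⟨0, by simp⟩
    | @cons a b c hab p ih =>
      obtain ⟨m, hm⟩ := ih
      rcases (abs_eq zero_le_one).1 hab.2 with h | h
      · exact ⟨m + 1, by push_cast; linarith⟩
      · exact ⟨m - 1, by push_cast; linarith⟩
  choose k hk using h
  exact ⟨k, fun i j => by rw [← hk, ← hk]; ring⟩

section Join

variable {V : Type u} {G : SimpleGraph V} {S : Set V}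

lemma connected_of_join (hS : S.Nonempty) (hSc : Sᶜ.Nonempty)
    (hG : ∀ i ∈ S, ∀ j ∉ S, G.Adj i j) : G.Connected := by
  obtain ⟨s, hs⟩ := hS
  obtain ⟨t, ht⟩ := hSc
  rw [SimpleGraph.connected_iff_exists_forall_reachable]
  refine ⟨t, fun w => ?_⟩
  by_cases hw : w ∈ S
  · exact (hG w hw t ht).symm.reachable
  · exact (hG s hs t ht).symm.reachable.trans (hG s hs w hw).reachable

/-- The facet function of a sign function. -/
def signFunction (g : V → SignType) : V → ℝ := fun i => (g i : ℝ)

lemma abs_signType_cast_eq_one {a : SignType} (ha : a ≠ 0) : |(a : ℝ)| = 1 := by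
  rcases SignType.eq_one_or_eq_neg_one ha with rfl | rfl <;> simp

lemma signType_cast_inj {a b : SignType} (h : (a : ℝ) = b) : a = b := by
  rcases a.trichotomy with rfl | rfl | rfl <;> rcases b.trichotomy with rfl | rfl | rfl <;>
    first | rfl | (norm_num at h)

/-- Each nonzero vertex is tightly joined to every vertex off `S`, and each zero in `S` to a nonzero
neighbour; domination also guarantees that a nonzero vertex exists. -/
lemma isFacetFunction_signFunction (hS : S.Nonempty) (hSc : Sᶜ.Nonempty)
    (hG : ∀ i ∈ S, ∀ j ∉ S, G.Adj i j) {g : V → SignType} (hg : g ∈ dominatingSigns G S) :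
    IsFacetFunction G (signFunction g) := by
  constructor
  · intro i j hij
    have := hg.2.1 i j hij
    revert this
    simp only [signFunction]
    generalize g i = a
    generalize g j = b
    cases a <;> cases b <;> simp <;> norm_num
  · obtain ⟨t, ht⟩ := hSc
    obtain ⟨s, hs⟩ := hS
    have hmem : ∀ i, g i ≠ 0 → i ∈ S := fun i hi => by
      by_contra h
      exact hi (hg.1 i h)
    have hadj : ∀ i j, G.Adj i j → g i = 0 → g j ≠ 0 → (tightGraph G (signFunction g)).Adj i j := by
      intro i j hij hi hj
      refine ⟨hij, ?_⟩
      simp only [signFunction]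
      rw [hi, SignType.coe_zero, zero_sub, abs_neg, abs_signType_cast_eq_one hj]
    have hnz : ∀ i, g i ≠ 0 → ∀ w ∉ S, (tightGraph G (signFunction g)).Reachable w i :=
      fun i hi w hw =>
        (hadj w i (hG i (hmem i hi) w hw).symm (hg.1 w hw) hi).reachable
    obtain ⟨r, hr⟩ : ∃ r, g r ≠ 0 := by
      by_cases h : g s = 0
      · obtain ⟨j, -, hj⟩ := hg.2.2 s hs h
        exact ⟨j, hj⟩
      · exact ⟨s, h⟩
    rw [SimpleGraph.connected_iff_exists_forall_reachable]
    refine ⟨t, fun w => ?_⟩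
    by_cases hw : w ∈ S
    · by_cases h0 : g w = 0
      · obtain ⟨j, hwj, hj⟩ := hg.2.2 w hw h0
        exact (hnz j hj t ht).trans (hadj w j hwj h0 hj).symm.reachable
      · exact hnz w h0 t ht
    · exact (hnz r hr t ht).trans (hnz r hr w hw).symm

lemma exists_signFunction_eq [Nontrivial V] (hSc : Sᶜ.Nonempty)
    (hG : ∀ i ∈ S, ∀ j ∉ S, G.Adj i j) {k : V → ℤ}
    (hk : IsFacetFunction G (fun i => (k i : ℝ))) (h0 : ∀ i ∉ S, k i = 0) :
    ∃ g ∈ dominatingSigns G S, signFunction g = fun i => (k i : ℝ) := by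
  obtain ⟨t, ht⟩ := hSc
  have hle : ∀ i j, G.Adj i j → k i - k j ≤ 1 := fun i j hij => by
    exact_mod_cast hk.sub_le i j hij
  have hcases : ∀ i, k i = -1 ∨ k i = 0 ∨ k i = 1 := by
    intro i
    by_cases hi : i ∈ S
    · have h1 := hle i t (hG i hi t ht)
      have h2 := hle t i (hG i hi t ht).symm
      rw [h0 t ht] at h1 h2
      omega
    · exact Or.inr (Or.inl (h0 i hi))
  have hs0 : ∀ i, SignType.sign (k i) = 0 ↔ k i = 0 := fun i => sign_eq_zero_iff
  refine ⟨fun i => SignType.sign (k i), ⟨fun i hi => ?_, fun i j hij h1 h2 => ?_,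
    fun i hi h => ?_⟩, ?_⟩
  · rw [hs0, h0 i hi]
  · have h1 := sign_eq_one_iff.1 h1
    have h2 := sign_eq_neg_one_iff.1 h2
    have := hle i j hij
    omega
  · rw [hs0] at h
    obtain ⟨j, hij, hj⟩ := hk.connected.preconnected.exists_adj_of_nontrivial i
    refine ⟨j, hij, fun hj0 => ?_⟩
    rw [hs0] at hj0
    simp [h, hj0] at hj
  · funext i
    simp only [signFunction]
    rcases hcases i with h | h | h <;> simp [h]

open Classical in
/-- The sign function with constant value `a` on `S` that vanishes elsewhere. -/
noncomputable def constSign (S : Set V) (a : SignType) : V → SignType :=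
  fun i => if i ∈ S then a else 0

lemma constSign_mem_dominatingSigns {a : SignType} (ha : a ≠ 0) :
    constSign S a ∈ dominatingSigns G S := by
  refine ⟨fun i hi => if_neg hi, fun i j _ h1 h2 => ?_, fun i hi h => ?_⟩
  · unfold constSign at h1 h2
    split_ifs at h1 h2 <;> simp_all
  · rw [constSign, if_pos hi] at h
    exact absurd h ha

variable [Fintype V] [DecidableEq V]

/-- The facets of functions that vanish off `S`. -/
def signFacets (G : SimpleGraph V) (S : Set V) : Set (Set (V → ℝ)) :=
  (fun g => sepFace G (signFunction g)) '' dominatingSigns G S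

/-- The faces of indicator functions that are constant neither on `S` nor on its complement. -/
def mixedFaces (G : SimpleGraph V) (S : Set V) : Set (Set (V → ℝ)) :=
  (fun T : Set V => sepFace G (T.indicator 1)) ''
    {T | T ∩ S ∈ 𝒫 S \ {∅, S} ∧ T ∩ Sᶜ ∈ 𝒫 Sᶜ \ {∅, Sᶜ}}

lemma ncard_signFacets (hS : S.Nonempty) (hSc : Sᶜ.Nonempty)
    (hG : ∀ i ∈ S, ∀ j ∉ S, G.Adj i j) :
    (signFacets G S).ncard = (dominatingSigns G S).ncard := by
  refine Set.InjOn.ncard_image fun g hg g' hg' h => ?_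
  obtain ⟨t, ht⟩ := hSc
  funext i
  have := (isFacetFunction_signFunction hS ⟨t, ht⟩ hG hg).sub_eq_of_sepFace_eq h i t
  simp only [signFunction, hg.1 t ht, hg'.1 t ht, SignType.coe_zero, sub_zero] at this
  exact signType_cast_inj this

lemma ncard_mixedFaces_le (hS : S.Nonempty) (hSc : Sᶜ.Nonempty) :
    (mixedFaces G S).ncard ≤ (2 ^ S.ncard - 2) * (2 ^ Sᶜ.ncard - 2) := by
  have hcard : ∀ A : Set V, A.Nonempty → (𝒫 A \ {∅, A}).ncard = 2 ^ A.ncard - 2 := by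
    intro A hA
    rw [Set.ncard_sdiff (by simp [Set.insert_subset_iff]) (Set.toFinite _),
      Set.ncard_powerset A (Set.toFinite _), Set.ncard_pair hA.ne_empty.symm]
  rw [← hcard S hS, ← hcard Sᶜ hSc, ← Set.ncard_prod]
  refine (Set.ncard_image_le (Set.toFinite _)).trans ?_
  refine Set.ncard_le_ncard_of_injOn (fun T => (T ∩ S, T ∩ Sᶜ)) (fun T hT => ⟨hT.1, hT.2⟩) ?_
    (Set.toFinite _)
  intro T _ T' _ h
  rw [Prod.mk.injEq] at h
  rw [← Set.inter_union_compl T S, ← Set.inter_union_compl T' S, h.1, h.2]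

lemma sepFace_constSign_compl (a : SignType) :
    sepFace G (signFunction (constSign Sᶜ (-a))) = sepFace G (signFunction (constSign S a)) := by
  refine sepFace_congr fun i j => ?_
  by_cases hi : i ∈ S <;> by_cases hj : j ∈ S <;> simp [signFunction, constSign, hi, hj]

lemma signFacets_inter_signFacets_compl (hS : S.Nonempty) (hSc : Sᶜ.Nonempty)
    (hG : ∀ i ∈ S, ∀ j ∉ S, G.Adj i j) :
    signFacets G S ∩ signFacets G Sᶜ =
      {sepFace G (signFunction (constSign S 1)), sepFace G (signFunction (constSign S (-1)))} := by
  apply Set.Subset.antisymm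
  · rintro _ ⟨⟨g, hg, rfl⟩, ⟨g', hg', h⟩⟩
    obtain ⟨s, hs⟩ := hS
    have hsub := (isFacetFunction_signFunction ⟨s, hs⟩ hSc hG hg).sub_eq_of_sepFace_eq h.symm
    have hconst : ∀ i ∈ S, g i = g s := by
      intro i hi
      have := hsub i s
      simp only [signFunction, hg'.1 i (by simpa using hi), hg'.1 s (by simpa using hs),
        sub_self, sub_eq_zero] at this
      exact signType_cast_inj this
    have hgs : g s ≠ 0 := by
      intro h0
      obtain ⟨j, -, hj⟩ := hg.2.2 s hs h0
      by_cases hjS : j ∈ S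
      · exact hj ((hconst j hjS).trans h0)
      · exact hj (hg.1 j hjS)
    have hgc : g = constSign S (g s) := by
      funext i
      by_cases hi : i ∈ S
      · rw [constSign, if_pos hi, hconst i hi]
      · rw [constSign, if_neg hi, hg.1 i hi]
    rcases SignType.eq_one_or_eq_neg_one hgs with h | h <;> rw [h] at hgc <;> simp [hgc]
  · have h : ∀ a : SignType, a ≠ 0 → sepFace G (signFunction (constSign S a)) ∈
        signFacets G S ∩ signFacets G Sᶜ := fun a ha =>
      ⟨⟨_, constSign_mem_dominatingSigns ha, rfl⟩,
        ⟨_, constSign_mem_dominatingSigns (a := -a) (by revert a; decide),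
          sepFace_constSign_compl a⟩⟩
    exact Set.insert_subset (h 1 (by decide)) (Set.singleton_subset_iff.2 (h (-1) (by decide)))

lemma ncard_signFacets_inter_signFacets_compl (hS : S.Nonempty) (hSc : Sᶜ.Nonempty)
    (hG : ∀ i ∈ S, ∀ j ∉ S, G.Adj i j) : (signFacets G S ∩ signFacets G Sᶜ).ncard = 2 := by
  rw [signFacets_inter_signFacets_compl hS hSc hG, Set.ncard_pair]
  intro h
  obtain ⟨s, hs⟩ := hS
  obtain ⟨t, ht⟩ := hSc
  have ht' : t ∉ S := ht
  have := (isFacetFunction_signFunction ⟨s, hs⟩ ⟨t, ht⟩ hG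
    (constSign_mem_dominatingSigns (a := 1) (by decide))).sub_eq_of_sepFace_eq h s t
  simp [signFunction, constSign, hs, ht'] at this
  norm_num at this

lemma sepFace_mem_signFacets_of_const [Nontrivial V] (hSc : Sᶜ.Nonempty)
    (hG : ∀ i ∈ S, ∀ j ∉ S, G.Adj i j) {k : V → ℤ}
    (hk : IsFacetFunction G (fun i => (k i : ℝ))) (hconst : ∀ i ∉ S, ∀ j ∉ S, k i ≤ k j) :
    sepFace G (fun i => (k i : ℝ)) ∈ signFacets G S := by
  obtain ⟨t, ht⟩ := hSc
  have hsub : ∀ i j, (k i : ℝ) - k j = ((k i - k t : ℤ) : ℝ) - ((k j - k t : ℤ) : ℝ) := by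
    intro i j; push_cast; ring
  obtain ⟨g, hg, hgk⟩ := exists_signFunction_eq ⟨t, ht⟩ hG (hk.congr hsub)
    (fun i hi => by have := hconst i hi t ht; have := hconst t ht i hi; omega)
  refine ⟨g, hg, ?_⟩
  simp only [hgk]
  exact (sepFace_congr hsub).symm

lemma sepFace_mem_union [Nontrivial V] (hS : S.Nonempty) (hSc : Sᶜ.Nonempty)
    (hG : ∀ i ∈ S, ∀ j ∉ S, G.Adj i j) {f : V → ℝ} (hf : IsFacetFunction G f) :
    sepFace G f ∈ signFacets G S ∪ signFacets G Sᶜ ∪ mixedFaces G S := by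
  obtain ⟨k, hfk⟩ := hf.exists_int
  rw [sepFace_congr hfk]
  have hk : IsFacetFunction G (fun i => (k i : ℝ)) := hf.congr hfk
  by_cases h1 : ∀ i ∉ S, ∀ j ∉ S, k i ≤ k j
  · exact Or.inl (Or.inl (sepFace_mem_signFacets_of_const hSc hG hk h1))
  by_cases h2 : ∀ i ∈ S, ∀ j ∈ S, k i ≤ k j
  · refine Or.inl (Or.inr (sepFace_mem_signFacets_of_const (S := Sᶜ) (by rwa [compl_compl])
      (fun i hi j hj => (hG j (by simpa using hj) i hi).symm) hk (fun i hi j hj => ?_)))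
    exact h2 i (by simpa using hi) j (by simpa using hj)
  right
  push Not at h1 h2
  obtain ⟨t₂, ht₂, t₁, ht₁, ht⟩ := h1
  obtain ⟨s₂, hs₂, s₁, hs₁, hs⟩ := h2
  have hle : ∀ i ∈ S, ∀ j ∉ S, k i - k j ≤ 1 ∧ k j - k i ≤ 1 := fun i hi j hj =>
    ⟨by exact_mod_cast hk.sub_le i j (hG i hi j hj),
      by exact_mod_cast hk.sub_le j i (hG i hi j hj).symm⟩
  have e11 := hle s₁ hs₁ t₁ ht₁
  have e12 := hle s₁ hs₁ t₂ ht₂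
  have e21 := hle s₂ hs₂ t₁ ht₁
  have e22 := hle s₂ hs₂ t₂ ht₂
  -- Two distinct values on each side, with all cross differences at most 1, leave only two
  -- consecutive integers.
  have hcases : ∀ i, k i = k s₁ ∨ k i = k s₁ + 1 := by
    intro i
    by_cases hi : i ∈ S
    · have := hle i hi t₁ ht₁
      have := hle i hi t₂ ht₂
      omega
    · have := hle s₁ hs₁ i hi
      have := hle s₂ hs₂ i hi
      omega
  refine ⟨{i | k i = k s₁ + 1}, ⟨⟨Set.inter_subset_right, ?_⟩, ⟨Set.inter_subset_right, ?_⟩⟩, ?_⟩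
  · rintro (h | h)
    · exact Set.eq_empty_iff_forall_notMem.1 h s₂ ⟨by have := hcases s₂; simp; omega, hs₂⟩
    · have := (h.symm ▸ hs₁ : s₁ ∈ {i | k i = k s₁ + 1} ∩ S).1
      simp at this
  · rintro (h | h)
    · exact Set.eq_empty_iff_forall_notMem.1 h t₂
        ⟨by have := hcases t₂; have := hcases t₁; simp; omega, ht₂⟩
    · have := (h.symm ▸ ht₁ : t₁ ∈ {i | k i = k s₁ + 1} ∩ Sᶜ).1
      have := hcases t₂
      simp at *
      omega
  · refine sepFace_congr fun i j => ?_
    have hind : ∀ i, ({i | k i = k s₁ + 1} : Set V).indicator (1 : V → ℝ) i = (k i : ℝ) - k s₁ := by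
      intro i
      rcases hcases i with h | h
      · rw [Set.indicator_of_notMem (by simp [h]), h]; simp
      · rw [Set.indicator_of_mem (by simp [h]), h]; simp
    rw [hind, hind]; ring

/-! ### Counting facets and the final bounds -/

lemma numFacets_add_two_bounds (hS : S.Nonempty) (hSc : Sᶜ.Nonempty)
    (hG : ∀ i ∈ S, ∀ j ∉ S, G.Adj i j) :
    2 ^ S.ncard + 2 ^ Sᶜ.ncard ≤ numFacets (symmetricEdgePolytope G) + 2 ∧
      numFacets (symmetricEdgePolytope G) ≤
        maxDominatingSigns (S.ncard + Sᶜ.ncard - 1) := by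
  have : Nontrivial V := by
    obtain ⟨s, hs⟩ := hS
    obtain ⟨t, ht⟩ := hSc
    exact ⟨s, t, fun h => ht (h ▸ hs)⟩
  have hG' : ∀ i ∈ Sᶜ, ∀ j ∉ Sᶜ, G.Adj i j := fun i hi j hj =>
    (hG j (by simpa using hj) i hi).symm
  have hScc : (Sᶜᶜ).Nonempty := by rwa [compl_compl]
  rw [numFacets_symmetricEdgePolytope (connected_of_join hS hSc hG)]
  have hfin : ∀ T : Set V, (signFacets G T).Finite := fun T => (Set.toFinite _).image _
  have hfin' : (mixedFaces G S).Finite := (Set.toFinite _).image _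
  have hsub : sepFace G '' {f | IsFacetFunction G f} ⊆
      signFacets G S ∪ signFacets G Sᶜ ∪ mixedFaces G S := by
    rintro _ ⟨f, hf, rfl⟩
    exact sepFace_mem_union hS hSc hG hf
  have hunion := Set.ncard_union_add_ncard_inter (signFacets G S) (signFacets G Sᶜ)
    (hfin S) (hfin Sᶜ)
  rw [ncard_signFacets_inter_signFacets_compl hS hSc hG, ncard_signFacets hS hSc hG,
    ncard_signFacets hSc hScc hG'] at hunion
  have hfinall := ((hfin S).union (hfin Sᶜ)).union hfin'
  constructor
  · have hsub' : signFacets G S ∪ signFacets G Sᶜ ⊆ sepFace G '' {f | IsFacetFunction G f} := by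
      rintro _ (⟨g, hg, rfl⟩ | ⟨g, hg, rfl⟩)
      · exact ⟨_, isFacetFunction_signFunction hS hSc hG hg, rfl⟩
      · exact ⟨_, isFacetFunction_signFunction hSc hScc hG' hg, rfl⟩
    -- The covering by three finite families also shows that there are finitely many facets, without
    -- which `ncard` would be 0.
    have := Set.ncard_le_ncard hsub' (hfinall.subset hsub)
    have := two_pow_ncard_le_ncard_dominatingSigns G S
    have := two_pow_ncard_le_ncard_dominatingSigns G Sᶜ
    omega
  · have h1 := (Set.ncard_le_ncard hsub hfinall).trans (Set.ncard_union_le _ _)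
    have h2 := ncard_mixedFaces_le (G := G) hS hSc
    have h3 := ncard_dominatingSigns_le G S
    have h4 := ncard_dominatingSigns_le G Sᶜ
    have h5 := maxDominatingSigns_add_le (Set.ncard_pos (Set.toFinite _) |>.2 hS)
      (Set.ncard_pos (Set.toFinite _) |>.2 hSc)
    omega

lemma numFacets_real_bounds (hS : S.Nonempty) (hSc : Sᶜ.Nonempty)
    (hG : ∀ i ∈ S, ∀ j ∉ S, G.Adj i j) {n : ℕ} (hn : n = Fintype.card V) :
    (Odd n →
      3 * (2 : ℝ) ^ (((n : ℝ) - 1) / 2) - 2 ≤ (numFacets (symmetricEdgePolytope G) : ℝ) ∧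
      (numFacets (symmetricEdgePolytope G) : ℝ) ≤ (6 : ℝ) ^ (((n : ℝ) - 1) / 2)) ∧
    (Even n →
      (2 : ℝ) ^ ((n : ℝ) / 2 + 1) - 2 ≤ (numFacets (symmetricEdgePolytope G) : ℝ) ∧
      (numFacets (symmetricEdgePolytope G) : ℝ) ≤ 14 * (6 : ℝ) ^ ((n : ℝ) / 2 - 2)) := by
  obtain ⟨hlow, hupp⟩ := numFacets_add_two_bounds hS hSc hG
  have hcard : S.ncard + Sᶜ.ncard = n := by
    rw [Set.ncard_add_ncard_compl, hn, Nat.card_eq_fintype_card]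
  rw [hcard] at hupp
  have hpos := (Set.ncard_pos (Set.toFinite _)).2 hS
  have hposc := (Set.ncard_pos (Set.toFinite _)).2 hSc
  constructor
  · rintro ⟨k, hk⟩
    have he : ((n : ℝ) - 1) / 2 = (k : ℕ) := by rw [hk]; push_cast; ring
    rw [he, Real.rpow_natCast, Real.rpow_natCast]
    have h1 := (three_mul_two_pow_le _ k _ (hcard.trans hk)).trans hlow
    rw [show n - 1 = 2 * k by omega, maxDominatingSigns_even] at hupp
    constructor
    · have : (3 * 2 ^ k : ℝ) ≤ numFacets (symmetricEdgePolytope G) + 2 := by exact_mod_cast h1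
      linarith
    · exact_mod_cast hupp
  · rintro ⟨k, hk⟩
    have he : (n : ℝ) / 2 = (k : ℕ) := by rw [hk]; push_cast; ring
    have h1 := (two_mul_two_pow_le _ k _ (hcard.trans (hk.trans (two_mul k).symm))).trans hlow
    rw [he]
    constructor
    · have : (2 * 2 ^ k : ℝ) ≤ numFacets (symmetricEdgePolytope G) + 2 := by exact_mod_cast h1
      rw [show (k : ℝ) + 1 = ((k + 1 : ℕ) : ℝ) by push_cast; ring, Real.rpow_natCast, pow_succ]
      linarith
    · match k with
      | 0 => omega
      -- For `n = 2` the exponent is -1: the facet count is at most 2, below `14 / 6`.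
      | 1 =>
        rw [show n - 1 = 1 by omega, maxDominatingSigns] at hupp
        have : (numFacets (symmetricEdgePolytope G) : ℝ) ≤ 2 := by exact_mod_cast hupp
        rw [show ((1 : ℕ) : ℝ) - 2 = -1 by norm_num, Real.rpow_neg_one]
        linarith
      | k + 2 =>
        rw [show n - 1 = 2 * k + 3 by omega, maxDominatingSigns_odd] at hupp
        rw [show ((k + 2 : ℕ) : ℝ) - 2 = (k : ℕ) by push_cast; ring, Real.rpow_natCast]
        exact_mod_cast hupp

end Join

/-- Take for `S` a connected component of the complement: no complement edge leaves it, so all cross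
pairs are edges of `G`. -/
lemma exists_join_of_not_connected_compl {V : Type u} [Nonempty V] {G : SimpleGraph V}
    (h : ¬ Gᶜ.Connected) :
    ∃ S : Set V, S.Nonempty ∧ Sᶜ.Nonempty ∧ ∀ i ∈ S, ∀ j ∉ S, G.Adj i j := by
  obtain ⟨v⟩ := ‹Nonempty V›
  rw [SimpleGraph.connected_iff_exists_forall_reachable] at h
  push Not at h
  obtain ⟨w, hw⟩ := h v
  refine ⟨{i | Gᶜ.Reachable v i}, ⟨v, SimpleGraph.Reachable.refl v⟩, ⟨w, hw⟩, fun i hi j hj => ?_⟩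
  by_contra hij
  have hne : i ≠ j := by rintro rfl; exact hj hi
  exact hj (SimpleGraph.Reachable.trans hi
    ((SimpleGraph.compl_adj G i j).2 ⟨hne, hij⟩).reachable)

theorem theorem1p4 :
    (∀ (V : Type u) (W : Type v) [Fintype V] [Fintype W] [DecidableEq V] [DecidableEq W]
        [Nonempty V] [Nonempty W] (G₁ : SimpleGraph V) (G₂ : SimpleGraph W) (n : ℕ),
      n = Fintype.card V + Fintype.card W →
      (Odd n →
        3 * (2 : ℝ) ^ (((n : ℝ) - 1) / 2) - 2
            ≤ (numFacets (symmetricEdgePolytope (graphJoin G₁ G₂)) : ℝ) ∧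
        (numFacets (symmetricEdgePolytope (graphJoin G₁ G₂)) : ℝ)
            ≤ (6 : ℝ) ^ (((n : ℝ) - 1) / 2)) ∧
      (Even n →
        (2 : ℝ) ^ ((n : ℝ) / 2 + 1) - 2
            ≤ (numFacets (symmetricEdgePolytope (graphJoin G₁ G₂)) : ℝ) ∧
        (numFacets (symmetricEdgePolytope (graphJoin G₁ G₂)) : ℝ)
            ≤ 14 * (6 : ℝ) ^ ((n : ℝ) / 2 - 2))) ∧
    (∀ (V : Type u) [Fintype V] [DecidableEq V] (G : SimpleGraph V) (n : ℕ),
      n = Fintype.card V → G.Connected → ¬ Gᶜ.Connected →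
      (Odd n →
        3 * (2 : ℝ) ^ (((n : ℝ) - 1) / 2) - 2 ≤ (numFacets (symmetricEdgePolytope G) : ℝ) ∧
        (numFacets (symmetricEdgePolytope G) : ℝ) ≤ (6 : ℝ) ^ (((n : ℝ) - 1) / 2)) ∧
      (Even n →
        (2 : ℝ) ^ ((n : ℝ) / 2 + 1) - 2 ≤ (numFacets (symmetricEdgePolytope G) : ℝ) ∧
        (numFacets (symmetricEdgePolytope G) : ℝ) ≤ 14 * (6 : ℝ) ^ ((n : ℝ) / 2 - 2))) := by
  refine ⟨?_, ?_⟩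
  · intro V W _ _ _ _ _ _ G₁ G₂ n hn
    obtain ⟨v⟩ := ‹Nonempty V›
    obtain ⟨w⟩ := ‹Nonempty W›
    refine numFacets_real_bounds (S := Set.range Sum.inl) ⟨Sum.inl v, v, rfl⟩
      ⟨Sum.inr w, by simp⟩ ?_ (by rw [hn, Fintype.card_sum])
    rintro _ ⟨i, rfl⟩ (j | j) hj
    · exact absurd ⟨j, rfl⟩ hj
    · simp [graphJoin]
  · intro V _ _ G n hn hG hGc
    have := hG.nonempty
    obtain ⟨S, hS, hSc, hjoin⟩ := exists_join_of_not_connected_compl hGc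
    exact numFacets_real_bounds hS hSc hjoin hn
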